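/- Let $\mathcal{L}_{\mathrm{val}}=\{+,\cdot,\mathcal{O}\}$ be the language of valued fields and let $\mathcal{L}$ be a one-sorted language expanding $\mathcal{L}_{\mathrm{val}}$. Let $K$ be an $\mathcal L$-structure that is a non-trivially valued field of equi-characteristic $0$ (i.e. both $K$ and its residue field have characteristic $0$, and the symbols of $\mathcal{L}_{\mathrm{val}}$ have their usual meaning in $K$), with valuation ring $\mathcal{O}_K\subsetneq K$ and valuation written multiplicatively $|\cdot|\colon K\to\Gamma_K=\Gamma_K^\times\cup\{0\}$, of arbitrary rank. For $\lambda\le 1$ in $\Gamma_K^\times$, let $\mathrm{RV}_\lambda=K^\times/\{1+x : |x|<\lambda\}\cup\{0\}$, let $\mathrm{rv}_\lambda\colon K\to\mathrm{RV}_\lambda$ be the projection extended by $\mathrm{rv}_\lambda(0)=0$, and put $\mathrm{RV}=\mathrm{RV}_1$. A finite non-empty set $C\subset K$ *$\lambda$-prepares* $X\subset K$ if for all $x,x'\in K$ with $\mathrm{rv}_\lambda(x-c)=\mathrm{rv}_\lambda(x'-c)$ for every $c\in C$, one has $x\in X\iff x'\in X$. The complete theory $\operatorname{Th}(K)$ of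 the $\mathcal{L}$-structure $K$ is *$1$-h-minimal* if every model $M$ of $\operatorname{Th}(K)$ has the following property: for every $\lambda\le 1$ in $\Gamma_M^\times$, every $A\subset M$ and every $A'\subset\mathrm{RV}_{M,\lambda}$ with at most one element, each set $X\subset M$ that is definable with parameters from $A\cup\mathrm{RV}_M\cup A'$ is $\lambda$-prepared by some finite non-empty $A$-definable set $C\subset M$. (Here a parameter $\xi$ from $\mathrm{RV}_M$ or $\mathrm{RV}_{M,\lambda}$ means a unary predicate for the preimage of $\xi$ in $M$.) **Theorem (Existence of derivatives).** Suppose that $\operatorname{Th}(K)$ is $1$-h-minimal, and let $f\colon K\to K$ be definable in $\mathcal{L}$ with parameters from $K$. Then the strict derivative of $f$ exists at all but finitely many points of $K$; that is, for all but finitely many $x\in K$ there exists $a\in K$ such that for each $\varepsilon\in\Gamma_K^\times$ there exists $\delta\in\Gamma_K^\times$ such that for all $y_1,y_2\in K$ with $|x-y_1|<\delta$, $|x-y_2|<\delta$ and $y_1\neq y_2$, $$\left|\frac{f(y_1)-f(y_2)}{y_1-y_2}-a\right|<\varepsilon .$$ -/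

import Mathlib

universe u v w w'

namespace HMin

/-- Function symbols of the language of valued fields: binary symbols `+` and `·`. -/
inductive ValFunctions : ℕ → Type
  | add : ValFunctions 2
  | mul : ValFunctions 2

/-- Relation symbols of the language of valued fields: a unary symbol for the valuation ring. -/
inductive ValRelations : ℕ → Type
  | valRing : ValRelations 1

/-- The language `{+, ·, 𝒪}` of valued fields. -/
def valLanguage : FirstOrder.Language.{0, 0} := ⟨ValFunctions, ValRelations⟩

/-- `M` is a non-trivially valued field of equi-characteristic zero with valuation ring `O`,
considered as a structure in the language `L`, which expands the language of valued fields
via `φ`: the symbols `+`, `·`, `𝒪` have their intended meaning. -/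
structure IsEquicharZeroValuedField {L : FirstOrder.Language.{u, v}} (φ : valLanguage →ᴸ L)
    (M : Type w) [Field M] [L.Structure M] (O : ValuationSubring M) : Prop where
  nontrivial : O ≠ ⊤
  charZero : CharZero M
  residue_charZero : CharZero (IsLocalRing.ResidueField O)
  add_eq : ∀ x y : M,
    FirstOrder.Language.Structure.funMap (φ.onFunction ValFunctions.add) ![x, y] = x + y
  mul_eq : ∀ x y : M,
    FirstOrder.Language.Structure.funMap (φ.onFunction ValFunctions.mul) ![x, y] = x * y
  mem_iff : ∀ x : M,
    FirstOrder.Language.Structure.RelMap (φ.onRelation ValRelations.valRing) ![x] ↔ x ∈ O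

section LeadingTerm

variable {M : Type w} [Field M] (O : ValuationSubring M)

/-- The elements `l ≤ 1` of the value group (zero excluded). -/
def Level : Type w := {l : O.ValueGroup // 0 < l ∧ l ≤ 1}

/-- The element `1` of the value group. -/
noncomputable def Level.one : Level O := ⟨1, zero_lt_one, le_rfl⟩

variable {O}

/-- The multiplicative group `1 + I`, where `I = {x | |x| < l}`. -/
def oneAdd (l : Level O) : Subgroup Mˣ where
  carrier := {a | O.valuation ((a : M) - 1) < l.1}
  one_mem' := by simpa using l.2.1
  mul_mem' := by
    intro a b ha hb
    simp only [Set.mem_ofPred_eq, Units.val_mul] at ha hb ⊢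
    have h : (a : M) * b - 1 = (a - 1) * (b - 1) + ((a - 1) + (b - 1)) := by ring
    have hab : O.valuation (((a : M) - 1) * (b - 1)) < l.1 := by
      rw [map_mul]
      calc O.valuation ((a : M) - 1) * O.valuation ((b : M) - 1)
          ≤ O.valuation ((a : M) - 1) * 1 := by
            gcongr
            exact hb.le.trans l.2.2
        _ < l.1 := by simpa using ha
    rw [h]
    exact Valuation.map_add_lt _ hab (Valuation.map_add_lt _ ha hb)
  inv_mem' := by
    intro a ha
    simp only [Set.mem_ofPred_eq] at ha ⊢
    have h1 : O.valuation (a : M) = 1 := by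
      have := Valuation.map_one_add_of_lt (v := O.valuation) (ha.trans_le l.2.2)
      simpa using this
    have h2 : ((a⁻¹ : Mˣ) : M) - 1 = -((a : M) - 1) * ((a : M))⁻¹ := by
      have := a.ne_zero
      rw [Units.val_inv_eq_inv_val]
      field_simp
      ring
    rw [h2, map_mul, map_inv₀, h1, Valuation.map_neg]
    simpa using ha

/-- The leading term structure `RV_l = Mˣ / (1 + I) ∪ {0}`. -/
abbrev RV (l : Level O) : Type w := WithZero (Mˣ ⧸ oneAdd l)

open Classical in
/-- The leading term map `rv_l : M → RV_l`. -/
noncomputable def rv (l : Level O) (x : M) : RV l :=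
  if h : x = 0 then 0 else ((QuotientGroup.mk (Units.mk0 x h) : Mˣ ⧸ oneAdd l) : RV l)

/-- The finite non-empty set `C` `l`-prepares the set `X`: whether `x ∈ X` depends only on
the tuple `(rv_l (x - c))` for `c ∈ C`. -/
def Prepares (l : Level O) (C X : Set M) : Prop :=
  C.Finite ∧ C.Nonempty ∧
    ∀ x x' : M, (∀ c ∈ C, rv l (x - c) = rv l (x' - c)) → (x ∈ X ↔ x' ∈ X)

end LeadingTerm

section Predicates

variable {M : Type w}

/-- The relation symbols for a family `P` of subsets of `M`: one unary predicate for each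
member of the family. -/
def PredRelations (P : Set (Set M)) : ℕ → Type w
  | 1 => P
  | _ => PEmpty

/-- The language with one unary predicate for each member of `P`. -/
def predLanguage (P : Set (Set M)) : FirstOrder.Language.{0, w} :=
  ⟨fun _ => Empty, PredRelations P⟩

/-- Each predicate is interpreted in `M` as the set it names. -/
instance predStructure (P : Set (Set M)) : (predLanguage P).Structure M where
  funMap f := Empty.elim f
  RelMap {n} := match n with
    | 1 => fun (r : P) x => x 0 ∈ r.1
    | 0 => fun r => PEmpty.elim r
    | _ + 2 => fun r => PEmpty.elim r

end Predicates

/-- `X ⊆ M` is `(A ∪ RV ∪ A')`-definable, where `A ⊆ M` and `A' ⊆ RV_l`: it is definable with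
parameters from `A` in the expansion of `L` by predicates for the preimages in `M` of the
elements of `RV = RV_1` and of `A'`. -/
def DefinableOverRV (L : FirstOrder.Language.{u, v}) {M : Type w} [Field M] [L.Structure M]
    {O : ValuationSubring M} (l : Level O) (A : Set M) (A' : Set (RV l)) (X : Set M) : Prop :=
  A.Definable₁
    (L.sum (predLanguage
      ({S | ∃ ξ : RV (Level.one O), S = rv (Level.one O) ⁻¹' {ξ}} ∪
        {S | ∃ ξ ∈ A', S = rv l ⁻¹' {ξ}}))) X

/-- `ℓ`-h-minimality (`ℓ = ⊤` stands for `ω`) of a theory `T` of valued fields of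
equi-characteristic zero, in a language `L` expanding the language of valued fields via `φ`.
The models range over the universe `w'`. -/
def IsHMinimal (ℓ : ℕ∞) {L : FirstOrder.Language.{u, v}} (φ : valLanguage →ᴸ L)
    (T : L.Theory) : Prop :=
  ∀ (M : Type w') [Field M] [L.Structure M] (O : ValuationSubring M),
    IsEquicharZeroValuedField φ M O → M ⊨ T →
    ∀ (l : Level O) (A : Set M) (A' : Set (RV l)), A'.encard ≤ ℓ →
      ∀ X : Set M, DefinableOverRV L l A A' X →
        ∃ C : Set M, A.Definable₁ L C ∧ Prepares l C X

/-- The strict derivative of `f` exists at `x`. -/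
def HasStrictDerivativeAt {K : Type w} [Field K] (O : ValuationSubring K) (f : K → K) (x : K) :
    Prop :=
  ∃ a : K, ∀ ε : O.ValueGroup, 0 < ε → ∃ δ : O.ValueGroup, 0 < δ ∧
    ∀ y₁ y₂ : K, O.valuation (x - y₁) < δ → O.valuation (x - y₂) < δ → y₁ ≠ y₂ →
      O.valuation ((f y₁ - f y₂) / (y₁ - y₂) - a) < ε

/-- `f : K → K` is definable in `L`, with arbitrary parameters from `K`. -/
def IsDefinableFunction (L : FirstOrder.Language.{u, v}) {K : Type w} [L.Structure K]
    (f : K → K) : Prop :=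
  (Set.univ : Set K).Definable₂ L {p : K × K | p.2 = f p.1}

end HMin

/-! Failure of strict differentiability is a first-order condition, so the bad set is prepared by a
finite set, and it suffices to find a good point in every ball. This is done in an ultrapower of
`K`, to which `f` extends and from which strict derivatives at points of `K` descend. Let acl(A) be
the union of the finite `A`-definable sets. For countable `A`, the ultrapower is saturated enough
that every closed ball of radius `|t|` has a point `a` at distance at least `|t|` from acl(A), and
that the nonzero elements of acl(A) have a common lower bound on their valuations.

Near such an `a`, preparation makes `rv_λ (g x - b)` constant at scale `λ|t|`, for `g` definable
over `A` and `b ∈ A`. Fitting `λ` to a pair `x`, `y` gives `|g x - g y| |t| ≤ |g a - b| |x - y|`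
(`lipschitz_of_avoiding`). Applied to the difference quotient of `f` with a fixed step `τ`, this
shows that the quotient is almost a constant `c`, so that translation by `τ` hardly changes `g = f -
c • id`. Residue characteristic zero passes this on to all smaller translations
(`translation_small_of_small`). A second use of the Lipschitz estimate, with `b` a value of `g`,
makes `g` `|k|`-Lipschitz near some point of any given ball (`exists_approxLinearAt`).

The precision `|k|` enters definitions only through an `RV` parameter, so the preparing sets stay in
the same acl for all `k`. Hence a point `a` outside acl(A) has approximate slopes of every
precision, and they can be taken in acl(A ∪ {a}). Distinct elements there differ by at least a fixed
valuation, so the slopes stabilise, and their eventual value is the strict derivative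
(`hasStrictDerivativeAt_of_notMem_acl`). -/

namespace HMin

/-! ### Calculus of definable sets and functions. -/

section Definability

variable {L : FirstOrder.Language.{u, v}} {M : Type w} [L.Structure M] {A : Set M} {α : Type*}

theorem definable_not {p : (α → M) → Prop} (hp : A.Definable L {v | p v}) :
    A.Definable L {v | ¬ p v} :=
  hp.compl

theorem definable_and {p q : (α → M) → Prop} (hp : A.Definable L {v | p v})
    (hq : A.Definable L {v | q v}) : A.Definable L {v | p v ∧ q v} :=
  hp.inter hq

theorem definable_or {p q : (α → M) → Prop} (hp : A.Definable L {v | p v})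
    (hq : A.Definable L {v | q v}) : A.Definable L {v | p v ∨ q v} :=
  hp.union hq

theorem definable_imp {p q : (α → M) → Prop} (hp : A.Definable L {v | p v})
    (hq : A.Definable L {v | q v}) : A.Definable L {v | p v → q v} := by
  simpa only [imp_iff_not_or] using definable_or (definable_not hp) hq

theorem definable_exists [Finite α] {p : (α → M) → M → Prop}
    (hp : A.Definable L {w : Option α → M | p (fun i => w (some i)) (w none)}) :
    A.Definable L {v | ∃ x, p v x} := by
  convert! hp.image_comp (some : α → Option α) using 1
  ext v
  constructor
  · rintro ⟨x, hx⟩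
    exact ⟨fun o => o.elim x v, hx, rfl⟩
  · rintro ⟨w, hw, rfl⟩
    exact ⟨w none, hw⟩

theorem definable_forall [Finite α] {p : (α → M) → M → Prop}
    (hp : A.Definable L {w : Option α → M | p (fun i => w (some i)) (w none)}) :
    A.Definable L {v | ∀ x, p v x} := by
  have := definable_not (definable_exists (p := fun v x => ¬ p v x) (definable_not hp))
  simpa only [not_exists, not_not] using this

theorem definableFun_of_graph {f : (α → M) → M}
    (h : A.Definable L {w : Option α → M | w none = f (fun i => w (some i))}) :
    A.DefinableFun L f := by
  rw [Set.DefinableFun]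
  convert! h using 1
  ext w
  simp [Function.tupleGraph, Function.comp_def, eq_comm]

theorem definable_mem_of_definable₁ {S : Set M} (hS : A.Definable₁ L S) {f : (α → M) → M}
    (hf : A.DefinableFun L f) : A.Definable L {v | f v ∈ S} :=
  Set.Definable.preimage_map (F := fun v (_ : Fin 1) => f v) (fun _ => hf) hS

theorem definableFun_app {f : M → M} (hf : A.DefinableFun L fun v : Fin 1 → M => f (v 0))
    {g : (α → M) → M} (hg : A.DefinableFun L g) : A.DefinableFun L fun v => f (g v) :=
  Set.DefinableFun.comp (g := fun v _ => g v) (fun _ => hg) hf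

/-- The field operations and the valuation ring of a valued field are definable in `L`. -/
structure DefinableValuedField (L : FirstOrder.Language.{u, v}) {M : Type w} [Field M] [L.Structure M]
    (O : ValuationSubring M) : Prop where
  add : (∅ : Set M).DefinableFun L fun v : Fin 2 → M => v 0 + v 1
  mul : (∅ : Set M).DefinableFun L fun v : Fin 2 → M => v 0 * v 1
  mem : (∅ : Set M).Definable₁ L (O : Set M)

theorem IsEquicharZeroValuedField.definableValuedField {φ : valLanguage →ᴸ L} [Field M]
    {O : ValuationSubring M} (h : IsEquicharZeroValuedField φ M O) :
    DefinableValuedField L O where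
  add := by
    convert! Set.DefinableFun.fun_symbol (M := M) (φ.onFunction ValFunctions.add) using 1
    ext v
    rw [← h.add_eq]
    congr 1
    ext i
    fin_cases i <;> rfl
  mul := by
    convert! Set.DefinableFun.fun_symbol (M := M) (φ.onFunction ValFunctions.mul) using 1
    ext v
    rw [← h.mul_eq]
    congr 1
    ext i
    fin_cases i <;> rfl
  mem := by
    rw [Set.Definable₁, Set.empty_definable_iff]
    refine ⟨(φ.onRelation ValRelations.valRing).formula ![FirstOrder.Language.Term.var 0], ?_⟩
    ext v
    simp only [Set.mem_ofPred_eq, FirstOrder.Language.Formula.realize_rel, SetLike.mem_coe]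
    rw [← h.mem_iff]
    refine iff_of_eq ?_
    congr 1
    ext i
    fin_cases i
    rfl

namespace DefinableValuedField

variable [Field M] {O : ValuationSubring M} (h : DefinableValuedField L O)
include h

theorem map_expansion {L' : FirstOrder.Language} [L'.Structure M] (φ : L →ᴸ L') [φ.IsExpansionOn M] :
    DefinableValuedField L' O :=
  ⟨Set.Definable.map_expansion h.add φ, Set.Definable.map_expansion h.mul φ,
    Set.Definable.map_expansion h.mem φ⟩

variable {f g : (α → M) → M} (hf : A.DefinableFun L f) (hg : A.DefinableFun L g)

include hf

theorem definable_mem : A.Definable L {v | f v ∈ O} :=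
  definable_mem_of_definable₁ (S := (O : Set M))
    (Set.Definable.mono h.mem (Set.empty_subset A)) hf

include hg

theorem definableFun_add : A.DefinableFun L fun v => f v + g v :=
  Set.DefinableFun.comp (g := fun v => ![f v, g v])
    (by intro i; fin_cases i <;> assumption) (h.add.mono (Set.empty_subset A))

theorem definableFun_mul : A.DefinableFun L fun v => f v * g v :=
  Set.DefinableFun.comp (g := fun v => ![f v, g v])
    (by intro i; fin_cases i <;> assumption) (h.mul.mono (Set.empty_subset A))

end DefinableValuedField

theorem definableFun_comp_some {f : (α → M) → M} (hf : A.DefinableFun L f) :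
    A.DefinableFun L fun w : Option α → M => f fun i => w (some i) := by
  apply definableFun_of_graph
  have := Set.Definable.preimage_comp
    (fun o : Option α => o.elim none (fun i => some (some i))) hf
  convert! this using 1
  ext w
  simp [Function.tupleGraph, Function.comp_def, eq_comm]

namespace DefinableValuedField

variable [Field M] {O : ValuationSubring M} (h : DefinableValuedField L O)
variable {f g : (α → M) → M} (hf : A.DefinableFun L f) (hg : A.DefinableFun L g)
include h hf

theorem definable_eq_zero : A.Definable L {v | f v = 0} := by
  simpa using (h.definableFun_add hf hf).ofPred_eq hf

include hg

theorem definableFun_sub : A.DefinableFun L fun v => f v - g v := by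
  apply definableFun_of_graph
  simp only [eq_sub_iff_add_eq]
  exact (h.definableFun_add (Set.DefinableFun.proj _) (definableFun_comp_some hg)).ofPred_eq
    (definableFun_comp_some hf)

theorem definableFun_div : A.DefinableFun L fun v => f v / g v := by
  apply definableFun_of_graph
  have hg' := definableFun_comp_some hg
  have h0 : A.DefinableFun L fun w : Option α → M => w none := Set.DefinableFun.proj _
  have := definable_or (definable_and (h.definable_eq_zero hg') (h.definable_eq_zero h0))
    (definable_and (definable_not (h.definable_eq_zero hg'))
      ((h.definableFun_mul h0 hg').ofPred_eq (definableFun_comp_some hf)))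
  convert! this using 1
  ext w
  simp only [Set.mem_ofPred_eq]
  by_cases hw : g (fun i => w (some i)) = 0
  · simp [hw]
  · simp [hw, eq_div_iff hw]

theorem definable_valuation_le [Finite α] :
    A.Definable L {v | O.valuation (f v) ≤ O.valuation (g v)} := by
  simp only [ValuationSubring.valuation_le_iff, Subtype.exists, exists_prop]
  apply definable_exists
  have h0 : A.DefinableFun L fun w : Option α → M => w none := Set.DefinableFun.proj _
  exact definable_and (h.definable_mem h0)
    ((h.definableFun_mul h0 (definableFun_comp_some hg)).ofPred_eq (definableFun_comp_some hf))

theorem definable_valuation_lt [Finite α] :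
    A.Definable L {v | O.valuation (f v) < O.valuation (g v)} := by
  simpa only [not_le] using definable_not (h.definable_valuation_le hg hf)

end DefinableValuedField

end Definability

/-! ### Leading terms and valuations. -/

section LeadingTermLemmas

variable {M : Type w} [Field M] {O : ValuationSubring M}

theorem rv_eq_of_valuation_sub_lt {l : Level O} {x y : M}
    (h : O.valuation (x - y) < l.1 * O.valuation x) : rv l x = rv l y := by
  have hx : x ≠ 0 := by
    rintro rfl
    simp at h
  have hy : y ≠ 0 := by
    rintro rfl
    rw [sub_zero] at h
    exact h.not_ge (mul_le_of_le_one_left' l.2.2)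
  have hvx : O.valuation x ≠ 0 := by simpa using hx
  rw [rv, rv, dif_neg hx, dif_neg hy, WithZero.coe_inj, QuotientGroup.eq]
  change O.valuation (((Units.mk0 x hx)⁻¹ * Units.mk0 y hy : Mˣ) - 1 : M) < l.1
  have : (((Units.mk0 x hx)⁻¹ * Units.mk0 y hy : Mˣ) - 1 : M) = (y - x) / x := by
    simp [field]
  rw [this, map_div₀, Valuation.map_sub_swap, div_lt_iff₀ (zero_lt_iff.2 hvx)]
  exact h

theorem valuation_sub_lt_of_rv_eq {l : Level O} {x y : M} (h : rv l x = rv l y) :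
    x = y ∨ O.valuation (x - y) < l.1 * O.valuation x := by
  by_cases hx : x = 0
  · by_cases hy : y = 0
    · exact Or.inl (hx.trans hy.symm)
    · rw [rv, rv, dif_pos hx, dif_neg hy] at h
      exact (WithZero.zero_ne_coe h).elim
  by_cases hy : y = 0
  · rw [rv, rv, dif_pos hy, dif_neg hx] at h
    exact (WithZero.coe_ne_zero h).elim
  rw [rv, rv, dif_neg hx, dif_neg hy, WithZero.coe_inj, QuotientGroup.eq] at h
  have h' : O.valuation (((Units.mk0 x hx)⁻¹ * Units.mk0 y hy : Mˣ) - 1 : M) < l.1 := h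
  have : (((Units.mk0 x hx)⁻¹ * Units.mk0 y hy : Mˣ) - 1 : M) = (y - x) / x := by
    simp [field]
  have hvx : O.valuation x ≠ 0 := by simpa using hx
  rw [this, map_div₀, Valuation.map_sub_swap, div_lt_iff₀ (zero_lt_iff.2 hvx)] at h'
  exact Or.inr h'

theorem valuation_eq_of_sub_lt {x y : M} (h : O.valuation (x - y) < O.valuation x) :
    O.valuation y = O.valuation x := by
  rw [← Valuation.map_sub_swap] at h
  simpa using Valuation.map_add_eq_of_lt_left O.valuation h

theorem valuation_eq_of_rv_eq {l : Level O} {x y : M} (h : rv l x = rv l y) :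
    O.valuation x = O.valuation y := by
  rcases valuation_sub_lt_of_rv_eq h with rfl | h
  · rfl
  · exact (valuation_eq_of_sub_lt (h.trans_le (mul_le_of_le_one_left' l.2.2))).symm

/-- A set prepared by `C` contains, around each of its points outside `C`, a ball. -/
theorem Prepares.exists_ball {l : Level O} {C X : Set M} (h : Prepares l C X) {x : M}
    (hx : x ∉ C) :
    ∃ t : M, t ≠ 0 ∧ ∀ y, O.valuation (y - x) < l.1 * O.valuation t → (x ∈ X ↔ y ∈ X) := by
  obtain ⟨c, hc, hmin⟩ := Set.exists_min_image C (fun c => O.valuation (x - c)) h.1 h.2.1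
  refine ⟨x - c, sub_ne_zero.2 fun e => hx (e ▸ hc), fun y hy => h.2.2 x y fun d hd => ?_⟩
  apply rv_eq_of_valuation_sub_lt
  rw [sub_sub_sub_cancel_right, Valuation.map_sub_swap]
  exact hy.trans_le (by gcongr; exact hmin d hd)

end LeadingTermLemmas

/-! ### Leading-term parameters and algebraic closure. -/

section Parameters

variable {L : FirstOrder.Language.{u, v}} {M : Type w} [L.Structure M] {A : Set M} {α : Type*}

theorem definable₁_of_mem_predicates {P : Set (Set M)} {S : Set M} (hS : S ∈ P) :
    A.Definable₁ (L.sum (predLanguage P)) S := by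
  refine Set.Definable.mono ?_ (Set.empty_subset A)
  rw [Set.empty_definable_iff]
  let R : (L.sum (predLanguage P)).Relations 1 := Sum.inr (⟨S, hS⟩ : P)
  refine ⟨R.formula ![FirstOrder.Language.Term.var 0], ?_⟩
  ext v
  simp only [Set.mem_ofPred_eq, FirstOrder.Language.Formula.realize_rel]
  rfl

variable [Field M] {O : ValuationSubring M}

/-- The language in which definability over `A ∪ RV ∪ {ξ}` is ordinary definability over `A`. -/
abbrev rvLanguage (L : FirstOrder.Language.{u, v}) [L.Structure M] {l : Level O} (ξ : RV l) :
    FirstOrder.Language.{u, max v w} :=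
  L.sum (predLanguage
      ({S | ∃ ξ : RV (Level.one O), S = rv (Level.one O) ⁻¹' {ξ}} ∪
        {S | ∃ η ∈ ({ξ} : Set (RV l)), S = rv l ⁻¹' {η}}))

theorem definable₁_rv_preimage {l : Level O} (ξ : RV l) :
    A.Definable₁ (rvLanguage L ξ) (rv l ⁻¹' {ξ}) :=
  definable₁_of_mem_predicates (Or.inr ⟨ξ, rfl, rfl⟩)

theorem definable₁_rv_one_preimage {l : Level O} (ξ : RV l) (ζ : RV (Level.one O)) :
    A.Definable₁ (rvLanguage L ξ) (rv (Level.one O) ⁻¹' {ζ}) :=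
  definable₁_of_mem_predicates (Or.inl ⟨ζ, rfl⟩)

/-- Only `|k|` matters, and it is determined by the class of `k` in `RV`. The predicate for that
class replaces `k`, which therefore need not belong to `A`. -/
theorem definable_valuation_le_mul [Finite α] (h : DefinableValuedField L O) {l : Level O}
    {ξ : RV l} {f g : (α → M) → M} (hf : A.DefinableFun (rvLanguage L ξ) f)
    (hg : A.DefinableFun (rvLanguage L ξ) g) (k : M) :
    A.Definable (rvLanguage L ξ)
      {v | O.valuation (f v) ≤ O.valuation k * O.valuation (g v)} := by
  have h' : DefinableValuedField (rvLanguage L ξ) O :=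
    h.map_expansion FirstOrder.Language.LHom.sumInl
  have key : A.Definable (rvLanguage L ξ) {v | ∃ y, y ∈ rv (Level.one O) ⁻¹' {rv (Level.one O) k} ∧
      O.valuation (f v) ≤ O.valuation (y * g v)} := by
    apply definable_exists
    have h0 : A.DefinableFun (rvLanguage L ξ) fun w : Option α → M => w none :=
      Set.DefinableFun.proj _
    exact definable_and (definable_mem_of_definable₁ (definable₁_rv_one_preimage ξ _) h0)
      (h'.definable_valuation_le (definableFun_comp_some hf)
        (h'.definableFun_mul h0 (definableFun_comp_some hg)))
  convert! key using 1
  ext v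
  simp only [Set.mem_ofPred_eq, Set.mem_preimage, Set.mem_singleton_iff, map_mul]
  constructor
  · exact fun hv => ⟨k, rfl, hv⟩
  · rintro ⟨y, hy, hv⟩
    rwa [← valuation_eq_of_rv_eq hy]

/-- The union of the finite `A`-definable sets. -/
def acl (L : FirstOrder.Language.{u, v}) {M : Type w} [L.Structure M] (A : Set M) : Set M :=
  {x | ∃ E : Set M, A.Definable₁ L E ∧ E.Finite ∧ x ∈ E}

/-- Needed to apply a lower bound on acl to the difference of two slopes. -/
theorem sub_mem_acl (h : DefinableValuedField L O) {x y : M} (hx : x ∈ acl L A)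
    (hy : y ∈ acl L A) : x - y ∈ acl L A := by
  obtain ⟨E, hE, hEf, hxE⟩ := hx
  obtain ⟨F, hF, hFf, hyF⟩ := hy
  refine ⟨Set.image2 (· - ·) E F, ?_, hEf.image2 _ hFf, Set.mem_image2_of_mem hxE hyF⟩
  have : A.Definable L {v : Fin 1 → M | ∃ p, ∃ q, p ∈ E ∧ q ∈ F ∧ p - q = v 0} := by
    apply definable_exists
    apply definable_exists
    have hp : A.DefinableFun L fun w : Option (Option (Fin 1)) → M => w (some none) :=
      Set.DefinableFun.proj _
    have hq : A.DefinableFun L fun w : Option (Option (Fin 1)) → M => w none :=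
      Set.DefinableFun.proj _
    exact definable_and (definable_mem_of_definable₁ hE hp)
      (definable_and (definable_mem_of_definable₁ hF hq)
        ((h.definableFun_sub hp hq).ofPred_eq (Set.DefinableFun.proj _)))
  rw [Set.Definable₁]
  convert! this using 1
  ext v
  simp [Set.mem_sub]

end Parameters

/-- A model of a `1`-h-minimal theory in which algebraic closures of countable sets avoid
suitable balls. -/
structure IsSparseModel (L : FirstOrder.Language.{u, v}) {M : Type w} [Field M] [L.Structure M]
    (O : ValuationSubring M) : Prop where
  nontrivial : ∃ e : M, e ≠ 0 ∧ O.valuation e < 1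
  valuation_natCast : ∀ n : ℕ, n ≠ 0 → O.valuation (n : M) = 1
  definable : DefinableValuedField L O
  prepared : ∀ (l : Level O) (A : Set M) (ξ : RV l) (X : Set M), DefinableOverRV L l A {ξ} X →
    ∃ C : Set M, A.Definable₁ L C ∧ Prepares l C X
  exists_avoiding : ∀ A : Set M, A.Countable → ∀ b t : M, t ≠ 0 →
    ∃ a, O.valuation (a - b) ≤ O.valuation t ∧
      ∀ z ∈ acl L A, O.valuation t ≤ O.valuation (a - z)
  exists_lower_bound : ∀ A : Set M, A.Countable → ∃ e : M, e ≠ 0 ∧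
    ∀ z ∈ acl L A, z ≠ 0 → O.valuation e ≤ O.valuation z

/-! ### Lipschitz estimates on balls that avoid acl. -/

namespace IsSparseModel

variable {L : FirstOrder.Language.{u, v}} {M : Type w} [Field M] [L.Structure M]
  {O : ValuationSubring M} (h : IsSparseModel L O) {A : Set M}
include h

/-- A preparing set lies in acl(A), so each of its points `c` satisfies `|x - c| = |a - c| ≥ |t|`. A
move by less than `l|t|` then leaves every `rv l (x - c)` unchanged. -/
theorem mem_iff_of_avoiding {l : Level O} {ξ : RV l} {X : Set M}
    (hX : DefinableOverRV L l A {ξ} X) {a t x y : M}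
    (ha : ∀ z ∈ acl L A, O.valuation t ≤ O.valuation (a - z))
    (hx : O.valuation (x - a) < O.valuation t)
    (hxy : O.valuation (x - y) < l.1 * O.valuation t) : x ∈ X ↔ y ∈ X := by
  obtain ⟨C, hC, hCX⟩ := h.prepared l A ξ X hX
  refine hCX.2.2 x y fun c hc => rv_eq_of_valuation_sub_lt ?_
  have hac := ha c ⟨C, hC, hCX.1, hc⟩
  have : O.valuation (x - c) = O.valuation (a - c) := by
    apply valuation_eq_of_sub_lt
    rw [sub_sub_sub_cancel_right, Valuation.map_sub_swap]
    exact hx.trans_le hac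
  rw [sub_sub_sub_cancel_right, this]
  exact hxy.trans_le (by gcongr)

theorem rv_sub_eq_of_avoiding (l : Level O) {g : M → M}
    (hg : A.DefinableFun L fun v : Fin 1 → M => g (v 0)) {b : M} (hb : b ∈ A) {a t x y : M}
    (ha : ∀ z ∈ acl L A, O.valuation t ≤ O.valuation (a - z))
    (hx : O.valuation (x - a) < O.valuation t)
    (hxy : O.valuation (x - y) < l.1 * O.valuation t) : rv l (g x - b) = rv l (g y - b) := by
  have hX : DefinableOverRV L l A {rv l (g x - b)}
      {z | g z - b ∈ rv l ⁻¹' {rv l (g x - b)}} := by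
    refine definable_mem_of_definable₁ (definable₁_rv_preimage (rv l (g x - b))) ?_
    exact Set.Definable.map_expansion
      (h.definable.definableFun_sub hg (L.definableFun_const _ hb)) FirstOrder.Language.LHom.sumInl
  exact ((h.mem_iff_of_avoiding hX ha hx hxy).1 rfl).symm

/-- A definable function is Lipschitz on each ball that avoids the algebraic closure. -/
theorem lipschitz_of_avoiding {g : M → M}
    (hg : A.DefinableFun L fun v : Fin 1 → M => g (v 0)) {b : M} (hb : b ∈ A) {a t x y : M}
    (ha : ∀ z ∈ acl L A, O.valuation t ≤ O.valuation (a - z))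
    (hx : O.valuation (x - a) < O.valuation t) (hy : O.valuation (y - a) < O.valuation t) :
    O.valuation (g x - g y) * O.valuation t ≤ O.valuation (g a - b) * O.valuation (x - y) := by
  have hxa : O.valuation (g x - b) = O.valuation (g a - b) :=
    valuation_eq_of_rv_eq (h.rv_sub_eq_of_avoiding (Level.one O) hg hb ha hx
      (by simpa [Level.one] using hx))
  have hxy : O.valuation (x - y) < O.valuation t := by
    rw [← sub_sub_sub_cancel_right x y a]
    exact Valuation.map_sub_lt _ hx hy
  rcases eq_or_ne (g x) (g y) with he | he
  · simp [he]
  have h1 := valuation_sub_lt_of_rv_eq (h.rv_sub_eq_of_avoiding (Level.one O) hg hb ha hx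
      (y := y) (by simpa [Level.one] using hxy))
  rw [sub_left_inj, sub_sub_sub_cancel_right] at h1
  replace h1 := h1.resolve_left he
  simp only [Level.one, one_mul] at h1
  have hpos : 0 < O.valuation (g x - b) := zero_le.trans_lt h1
  have hne : 0 < O.valuation (g x - g y) := by
    simpa [zero_lt_iff, sub_eq_zero] using he
  by_contra! hlt
  rw [← hxa] at hlt
  -- This level is chosen so that `l * |g x - b| = |g x - g y|`. If the estimate fails, then `|x -
  -- y| < l|t|`, and equality of leading terms at level `l` yields `|g x - g y| < |g x - g y|`.
  let l : Level O := ⟨O.valuation (g x - g y) / O.valuation (g x - b), div_pos hne hpos,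
    ((div_lt_one₀ hpos).2 h1).le⟩
  have h2 := valuation_sub_lt_of_rv_eq (h.rv_sub_eq_of_avoiding l hg hb ha hx (y := y) (by
    change _ < _ / _ * _
    rw [div_mul_eq_mul_div, lt_div_iff₀ hpos, mul_comm]
    exact hlt))
  rw [sub_left_inj, sub_sub_sub_cancel_right] at h2
  replace h2 := h2.resolve_left he
  change _ < _ / _ * _ at h2
  rw [div_mul_cancel₀ _ hpos.ne'] at h2
  exact h2.false

end IsSparseModel

/-- The points `b + n * t` are at mutual distance exactly `|t|`, since nonzero integers have
valuation one. So each `c` is closer than `|t|` to at most one of them. -/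
theorem exists_nat_avoiding {M : Type w} [Field M] {O : ValuationSubring M}
    (h : ∀ n : ℕ, n ≠ 0 → O.valuation (n : M) = 1) {C : Set M} (hC : C.Finite) (b t : M) :
    ∃ n : ℕ, ∀ c ∈ C, O.valuation t ≤ O.valuation (b + n * t - c) := by
  by_contra! hcon
  choose z hz using hcon
  have := hC.to_subtype
  obtain ⟨n, n', hne, hnn⟩ := Finite.exists_ne_map_eq_of_infinite
    (fun n => (⟨z n, (hz n).1⟩ : C))
  wlog hlt : n' < n generalizing n n'
  · exact this n' n hne.symm hnn.symm (lt_of_le_of_ne (not_lt.1 hlt) hne)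
  have h1 := Valuation.map_sub_lt O.valuation (hz n).2 (hz n').2
  rw [show z n = z n' from congrArg Subtype.val hnn, sub_sub_sub_cancel_right,
    add_sub_add_left_eq_sub, ← sub_mul, ← Nat.cast_sub hlt.le,
    map_mul, h _ (Nat.sub_ne_zero_of_lt hlt), one_mul] at h1
  exact h1.false

/-- `f - c • id` is `|k|`-Lipschitz on a neighbourhood of `a`. -/
def ApproxLinearAt {M : Type w} [Field M] (O : ValuationSubring M) (f : M → M) (c k a : M) :
    Prop :=
  ∃ d : M, d ≠ 0 ∧ ∀ x y, O.valuation (x - a) < O.valuation d →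
    O.valuation (y - a) < O.valuation d →
    O.valuation (f x - f y - c * (x - y)) ≤ O.valuation k * O.valuation (x - y)

/-! ### Approximate linearity in every ball. -/

namespace IsSparseModel

variable {L : FirstOrder.Language.{u, v}} {M : Type w} [Field M] [L.Structure M]
  {O : ValuationSubring M} (h : IsSparseModel L O) {A : Set M}
include h

/-- If translating by `τ` changes `g` by less than `|m|` on a ball, then so does translating by
anything smaller than `τ`. -/
theorem translation_small_of_small {g : M → M}
    (hg : A.DefinableFun L fun v : Fin 1 → M => g (v 0)) {a r m τ : M}
    (hτr : O.valuation τ < O.valuation r)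
    (hτg : ∀ x, O.valuation (x - a) < O.valuation r →
      O.valuation (g (x + τ) - g x) < O.valuation m)
    {σ x : M} (hσ : O.valuation σ < O.valuation τ) (hx : O.valuation (x - a) < O.valuation r) :
    O.valuation (g (x + σ) - g x) < O.valuation m := by
  set T : Set M := {ρ | O.valuation ρ < O.valuation r ∧ ∀ x, O.valuation (x - a) < O.valuation r →
    O.valuation (g (x + ρ) - g x) < O.valuation m}
  -- No leading-term parameter is used here; the class `0` merely fills the slot.
  have hTdef : DefinableOverRV L (Level.one O) (A ∪ {a, r, m}) {(0 : RV (Level.one O))} T := by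
    refine Set.Definable.map_expansion ?_ FirstOrder.Language.LHom.sumInl
    have hp {n : Type} (i : n) : (A ∪ {a, r, m}).DefinableFun L fun v : n → M => v i :=
      Set.DefinableFun.proj _
    have hc {n : Type} {b : M} (hb : b ∈ A ∪ {a, r, m}) :
        (A ∪ {a, r, m}).DefinableFun L fun _ : n → M => b := L.definableFun_const _ hb
    have hg' := hg.mono (Set.subset_union_left (t := {a, r, m}))
    apply definable_and (h.definable.definable_valuation_lt (hp 0) (hc (by simp)))
    apply definable_forall
    exact definable_imp (h.definable.definable_valuation_lt
        (h.definable.definableFun_sub (hp none) (hc (by simp))) (hc (by simp)))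
      (h.definable.definable_valuation_lt
        (h.definable.definableFun_sub
          (definableFun_app hg' (h.definable.definableFun_add (hp none) (hp (some 0))))
          (definableFun_app hg' (hp none)))
        (hc (by simp)))
  obtain ⟨C, -, hC⟩ := h.prepared _ _ _ _ hTdef
  -- The ball of radius `|r|` around `a` is stable under translation by `n * τ`, so the bounds for
  -- the successive steps combine by the ultrametric inequality.
  have hnat (n : ℕ) : (n : M) * τ ∈ T := by
    induction n with
    | zero =>
      refine ⟨by simpa using zero_le.trans_lt hτr, fun x hx => ?_⟩
      simpa using zero_le.trans_lt (hτg x hx)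
    | succ n ih =>
      rw [Nat.cast_succ, add_one_mul]
      refine ⟨Valuation.map_add_lt _ ih.1 hτr, fun x hx => ?_⟩
      have hx' : O.valuation (x + n * τ - a) < O.valuation r := by
        rw [add_sub_right_comm]
        exact Valuation.map_add_lt _ hx ih.1
      rw [← add_assoc, ← sub_add_sub_cancel _ (g (x + n * τ))]
      exact Valuation.map_add_lt _ (hτg _ hx') (ih.2 x hx)
  obtain ⟨n, hn⟩ := exists_nat_avoiding h.valuation_natCast hC.1 0 τ
  simp only [zero_add] at hn
  have hmem : n * τ + σ ∈ T := by
    refine (hC.2.2 (n * τ) (n * τ + σ) fun c hc => rv_eq_of_valuation_sub_lt ?_).1 (hnat n)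
    rw [sub_sub_sub_cancel_right, sub_add_cancel_left, Valuation.map_neg]
    simpa [Level.one] using hσ.trans_le (hn c hc)
  have hx' : O.valuation (x - n * τ - a) < O.valuation r := by
    rw [sub_right_comm]
    exact Valuation.map_sub_lt _ hx (hnat n).1
  -- Translation by `σ` is translation by `n * τ + σ` followed by translation back by `n * τ`, and
  -- both are small.
  have e : g (x + σ) - g x = (g (x - n * τ + (n * τ + σ)) - g (x - n * τ)) -
      (g (x - n * τ + n * τ) - g (x - n * τ)) := by
    rw [sub_sub_sub_cancel_right, sub_add_cancel, ← add_assoc, sub_add_cancel]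
  rw [e]
  exact Valuation.map_sub_lt _ (hmem.2 _ hx') ((hnat n).2 _ hx')

/-- Every ball contains a ball on which a definable function is `|m|`-Lipschitz, for some `m`. -/
theorem exists_lipschitz_ball (hA : A.Countable) {g : M → M}
    (hg : A.DefinableFun L fun v : Fin 1 → M => g (v 0)) (b : M) {t k : M} (ht : t ≠ 0)
    (hk : k ≠ 0) : ∃ a m : M, O.valuation (a - b) ≤ O.valuation t ∧ m ≠ 0 ∧
      O.valuation k ≤ O.valuation m ∧
      ∀ x y, O.valuation (x - a) < O.valuation t → O.valuation (y - a) < O.valuation t →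
        O.valuation (g x - g y) ≤ O.valuation m * O.valuation (x - y) := by
  obtain ⟨a, hab, ha⟩ := h.exists_avoiding (insert 0 A) (hA.insert 0) b t ht
  have ht' : 0 < O.valuation t := by simpa [zero_lt_iff] using ht
  obtain ⟨m, hm0, hkm, hm⟩ : ∃ m : M, m ≠ 0 ∧ O.valuation k ≤ O.valuation m ∧
      O.valuation (g a) ≤ O.valuation m * O.valuation t := by
    rcases le_total (O.valuation (g a / t)) (O.valuation k) with hle | hle
    · refine ⟨k, hk, le_rfl, ?_⟩
      rwa [map_div₀, div_le_iff₀ ht'] at hle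
    · refine ⟨g a / t, ?_, hle, ?_⟩
      · intro h0
        rw [h0, map_zero, nonpos_iff_eq_zero, Valuation.zero_iff] at hle
        exact hk hle
      · rw [← map_mul, div_mul_cancel₀ _ ht]
  refine ⟨a, m, hab, hm0, hkm, fun x y hx hy => ?_⟩
  have := h.lipschitz_of_avoiding (hg.mono (Set.subset_insert 0 A)) (Set.mem_insert 0 A) ha hx hy
  rw [sub_zero] at this
  refine le_of_mul_le_mul_right (this.trans ?_) ht'
  rw [mul_right_comm]
  gcongr

/-- Every ball contains points where a definable function is approximately linear, to any given
precision. -/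
theorem exists_approxLinearAt (hA : A.Countable) {f : M → M}
    (hf : A.DefinableFun L fun v : Fin 1 → M => f (v 0)) (b : M) {t k : M} (ht : t ≠ 0)
    (hk : k ≠ 0) : ∃ a c : M, O.valuation (a - b) ≤ O.valuation t ∧ ApproxLinearAt O f c k a := by
  obtain ⟨e, he0, he⟩ := h.nontrivial
  have hmul {x : M} (hx : x ≠ 0) : O.valuation (e * x) < O.valuation x := by
    rw [map_mul]
    exact mul_lt_of_lt_one_left (by simpa [zero_lt_iff] using hx) he
  obtain ⟨a₁, m, ha₁, hm0, hkm, hlip⟩ := h.exists_lipschitz_ball hA hf b ht (mul_ne_zero he0 hk)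
  -- The scales satisfy `|τ| < |r| ≤ |s| < |t|`. The factor `e * k / m` in `r` offsets the Lipschitz
  -- constant: over radius `|r|` the difference quotient varies by less than `|m| |r| / |s| = |e *
  -- k|`.
  set s := e * t
  set r := e * k / m * s with hr
  set τ := e * r
  have hs0 : s ≠ 0 := mul_ne_zero he0 ht
  have hr0 : r ≠ 0 := mul_ne_zero (div_ne_zero (mul_ne_zero he0 hk) hm0) hs0
  have hτ0 : τ ≠ 0 := mul_ne_zero he0 hr0
  have hst : O.valuation s < O.valuation t := hmul ht
  have hrs : O.valuation r ≤ O.valuation s := by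
    rw [hr, map_mul, map_div₀]
    refine mul_le_of_le_one_left' (div_le_one_of_le₀ hkm zero_le)
  have hτr : O.valuation τ < O.valuation r := hmul hr0
  have hpos {x : M} (hx : x ≠ 0) : 0 < O.valuation x := by simpa [zero_lt_iff] using hx
  let q : M → M := fun x => (f (x + τ) - f x) / τ
  let A' : Set M := insert 0 (insert τ A)
  have hA' : A'.Countable := (hA.insert τ).insert 0
  have hAA' : A ⊆ A' := (Set.subset_insert τ A).trans (Set.subset_insert 0 _)
  have hq : A'.DefinableFun L fun v : Fin 1 → M => q (v 0) := by
    have hτc : A'.DefinableFun L fun _ : Fin 1 → M => τ :=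
      L.definableFun_const _ (by simp [A'])
    have hp : A'.DefinableFun L fun v : Fin 1 → M => v 0 := Set.DefinableFun.proj _
    exact h.definable.definableFun_div (h.definable.definableFun_sub
      (definableFun_app (hf.mono hAA') (h.definable.definableFun_add hp hτc))
      (hf.mono hAA')) hτc
  obtain ⟨a₀, ha₀, hav⟩ := h.exists_avoiding A' hA' a₁ s hs0
  set c := q a₀ with hc
  have hmc : O.valuation c ≤ O.valuation m := by
    have ha' : O.valuation (a₀ - a₁) < O.valuation t := ha₀.trans_lt hst
    have := hlip (a₀ + τ) a₀ (by
      rw [add_sub_right_comm]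
      exact Valuation.map_add_lt _ ha' (hτr.trans (hrs.trans_lt hst))) ha'
    rw [add_sub_cancel_left] at this
    rw [hc]
    change O.valuation (_ / _) ≤ _
    rwa [map_div₀, div_le_iff₀ (hpos hτ0)]
  have hqc (x : M) (hx : O.valuation (x - a₀) < O.valuation r) :
      O.valuation (q x - c) < O.valuation (e * k) := by
    have := h.lipschitz_of_avoiding hq (b := 0) (by simp [A']) hav (hx.trans_le hrs)
      (y := a₀) (by simpa using hpos hs0)
    rw [sub_zero] at this
    refine lt_of_mul_lt_mul_right ((this.trans_lt ?_)) (a := O.valuation s) zero_le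
    calc O.valuation c * O.valuation (x - a₀) ≤ O.valuation m * O.valuation (x - a₀) := by gcongr
      _ < O.valuation m * O.valuation r := mul_lt_mul_of_pos_left hx (hpos hm0)
      _ = O.valuation (e * k) * O.valuation s := by
        rw [← map_mul, ← map_mul, hr]
        congr 1
        field_simp
  let g : M → M := fun x => f x - c * x
  have hgτ (x : M) (hx : O.valuation (x - a₀) < O.valuation r) :
      O.valuation (g (x + τ) - g x) < O.valuation (e * k * τ) := by
    have : g (x + τ) - g x = (q x - c) * τ := by
      simp only [g, q]
      field_simp
      ring
    rw [this, map_mul, map_mul _ (e * k)]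
    exact mul_lt_mul_of_pos_right (hqc x hx) (hpos hτ0)
  have hg : (insert c A).DefinableFun L fun v : Fin 1 → M => g (v 0) :=
    h.definable.definableFun_sub (hf.mono (Set.subset_insert c A))
      (h.definable.definableFun_mul (L.definableFun_const _ (by simp))
        (Set.DefinableFun.proj _))
  have hτ'0 : e * τ ≠ 0 := mul_ne_zero he0 hτ0
  -- With `g a₀` among the parameters, the Lipschitz estimate can be taken relative to `b = g a₀`.
  -- Its constant `|g a₂ - g a₀|` is below `|e * k * τ|`, by translation from `a₀` to `a₂`; dividing
  -- by the radius `|e * τ|` leaves `|k|`.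
  obtain ⟨a₂, ha₂, hav₂⟩ := h.exists_avoiding (insert (g a₀) (insert c A))
    ((hA.insert _).insert _) a₀ (e * τ) hτ'0
  refine ⟨a₂, c, ?_, e * τ, hτ'0, fun x y hx hy => ?_⟩
  · rw [← sub_add_sub_cancel a₂ a₀, ← sub_add_sub_cancel a₀ a₁]
    refine Valuation.map_add_le _ ?_ (Valuation.map_add_le _ (ha₀.trans hst.le) ha₁)
    exact ha₂.trans (((hmul hτ0).trans hτr).le.trans (hrs.trans hst.le))
  · have h1 := h.lipschitz_of_avoiding (hg.mono (Set.subset_insert (g a₀) _))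
      (Set.mem_insert _ _) hav₂ hx hy
    have h2 : O.valuation (g a₂ - g a₀) < O.valuation (e * k * τ) := by
      have := h.translation_small_of_small hg hτr hgτ (σ := a₂ - a₀) (x := a₀)
        (ha₂.trans_lt (hmul hτ0)) (by simpa using hpos hr0)
      rwa [add_sub_cancel] at this
    have e1 : f x - f y - c * (x - y) = g x - g y := by
      simp only [g]
      ring
    rw [e1]
    refine le_of_mul_le_mul_right (h1.trans ?_) (hpos hτ'0)
    have e2 : e * k * τ = k * (e * τ) := by ring
    rw [e2, map_mul] at h2
    rw [mul_right_comm]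
    gcongr

end IsSparseModel

/-- Quantifiers over the value group become quantifiers over nonzero field elements, which makes the
condition first-order in `L`. -/
theorem hasStrictDerivativeAt_iff {M : Type w} [Field M] {O : ValuationSubring M} {f : M → M}
    {x : M} : HasStrictDerivativeAt O f x ↔ ∃ a : M, ∀ e : M, e ≠ 0 → ∃ d : M, d ≠ 0 ∧
      ∀ y₁ y₂ : M, O.valuation (x - y₁) < O.valuation d → O.valuation (x - y₂) < O.valuation d →
        y₁ ≠ y₂ → O.valuation ((f y₁ - f y₂) / (y₁ - y₂) - a) < O.valuation e := by
  have hpos (e : M) : 0 < O.valuation e ↔ e ≠ 0 := by simp [zero_lt_iff]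
  simp only [HasStrictDerivativeAt, O.valuation_surjective.forall, O.valuation_surjective.exists,
    hpos]

theorem ApproxLinearAt.mono {M : Type w} [Field M] {O : ValuationSubring M} {f : M → M}
    {c c' k k' a : M} (h : ApproxLinearAt O f c k a) (hk : O.valuation k ≤ O.valuation k')
    (hc : O.valuation (c - c') ≤ O.valuation k') : ApproxLinearAt O f c' k' a := by
  obtain ⟨d, hd, hfd⟩ := h
  refine ⟨d, hd, fun x y hx hy => ?_⟩
  have : f x - f y - c' * (x - y) = (f x - f y - c * (x - y)) + (c - c') * (x - y) := by ring
  rw [this]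
  refine Valuation.map_add_le _ ((hfd x y hx hy).trans (by gcongr)) ?_
  rw [map_mul]
  gcongr

/-! ### Convergence of slopes and strict differentiability. -/

namespace IsSparseModel

variable {L : FirstOrder.Language.{u, v}} {M : Type w} [Field M] [L.Structure M]
  {O : ValuationSubring M} (h : IsSparseModel L O) {A : Set M}
include h

theorem exists_small {d : M} (hd : d ≠ 0) : ∃ x : M, x ≠ 0 ∧ O.valuation x < O.valuation d := by
  obtain ⟨e, he0, he⟩ := h.nontrivial
  refine ⟨e * d, mul_ne_zero he0 hd, ?_⟩
  rw [map_mul]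
  exact mul_lt_of_lt_one_left (by simpa [zero_lt_iff] using hd) he

theorem valuation_sub_le_of_approxLinearAt {f : M → M} {c c' k a : M}
    (hc : ApproxLinearAt O f c k a) (hc' : ApproxLinearAt O f c' k a) :
    O.valuation (c - c') ≤ O.valuation k := by
  obtain ⟨d, hd, hfd⟩ := hc
  obtain ⟨d', hd', hfd'⟩ := hc'
  obtain ⟨x, hx0, hx⟩ : ∃ x : M, x ≠ 0 ∧
      O.valuation x < O.valuation d ∧ O.valuation x < O.valuation d' := by
    rcases le_total (O.valuation d) (O.valuation d') with hle | hle
    · obtain ⟨x, hx0, hx⟩ := h.exists_small hd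
      exact ⟨x, hx0, hx, hx.trans_le hle⟩
    · obtain ⟨x, hx0, hx⟩ := h.exists_small hd'
      exact ⟨x, hx0, hx.trans_le hle, hx⟩
  have hpos {x : M} (hx : x ≠ 0) : 0 < O.valuation x := by simpa [zero_lt_iff] using hx
  have h1 := hfd (a + x) a (by simpa using hx.1) (by simpa using hpos hd)
  have h2 := hfd' (a + x) a (by simpa using hx.2) (by simpa using hpos hd')
  have h3 := Valuation.map_sub_le O.valuation h2 h1
  rw [sub_sub_sub_cancel_left, ← sub_mul, map_mul, add_sub_cancel_left] at h3
  exact le_of_mul_le_mul_right h3 (hpos hx0)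

section Definability

variable {α : Type*} [Finite α] {l : Level O} {ξ : RV l} {f : M → M}

theorem definable_approxLinearAt (hf : A.DefinableFun L fun v : Fin 1 → M => f (v 0)) (k : M)
    {c a : (α → M) → M} (hc : A.DefinableFun L c) (ha : A.DefinableFun L a) :
    A.Definable (rvLanguage L ξ) {v | ApproxLinearAt O f (c v) k (a v)} := by
  have h' : DefinableValuedField (rvLanguage L ξ) O :=
    h.definable.map_expansion FirstOrder.Language.LHom.sumInl
  have hf' : A.DefinableFun (rvLanguage L ξ) fun v : Fin 1 → M => f (v 0) :=
    Set.Definable.map_expansion hf FirstOrder.Language.LHom.sumInl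
  have hc' : A.DefinableFun (rvLanguage L ξ) c :=
    Set.Definable.map_expansion hc FirstOrder.Language.LHom.sumInl
  have ha' : A.DefinableFun (rvLanguage L ξ) a :=
    Set.Definable.map_expansion ha FirstOrder.Language.LHom.sumInl
  have hp {n : Type _} (i : n) : A.DefinableFun (rvLanguage L ξ) fun v : n → M => v i :=
    Set.DefinableFun.proj _
  apply definable_exists
  apply definable_and
  · exact definable_not (h'.definable_eq_zero (hp none))
  apply definable_forall
  apply definable_forall
  have ha₃ := definableFun_comp_some (definableFun_comp_some (definableFun_comp_some ha'))
  have hc₃ := definableFun_comp_some (definableFun_comp_some (definableFun_comp_some hc'))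
  have hd := hp (some (some none) : Option (Option (Option α)))
  have hx := hp (some none : Option (Option (Option α)))
  have hy := hp (none : Option (Option (Option α)))
  exact definable_imp (h'.definable_valuation_lt (h'.definableFun_sub hx ha₃) hd)
    (definable_imp (h'.definable_valuation_lt (h'.definableFun_sub hy ha₃) hd)
    (definable_valuation_le_mul h.definable
      (h'.definableFun_sub (h'.definableFun_sub (definableFun_app hf' hx) (definableFun_app hf' hy))
        (h'.definableFun_mul hc₃ (h'.definableFun_sub hx hy)))
      (h'.definableFun_sub hx hy) k))

theorem definable_hasStrictDerivativeAt
    (hf : A.DefinableFun L fun v : Fin 1 → M => f (v 0)) :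
    A.Definable L {v : Fin 1 → M | HasStrictDerivativeAt O f (v 0)} := by
  simp only [hasStrictDerivativeAt_iff]
  have hp {n : Type} (i : n) : A.DefinableFun L fun v : n → M => v i := Set.DefinableFun.proj _
  apply definable_exists
  apply definable_forall
  apply definable_imp (definable_not (h.definable.definable_eq_zero (hp none)))
  apply definable_exists
  apply definable_and (definable_not (h.definable.definable_eq_zero (hp none)))
  apply definable_forall
  apply definable_forall
  have hx := hp (some (some (some (some (some (0 : Fin 1))))))
  have ha := hp (some (some (some (some (none : Option (Fin 1))))))
  have he := hp (some (some (some (none : Option (Option (Fin 1))))))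
  have hd := hp (some (some (none : Option (Option (Option (Fin 1))))))
  have h₁ := hp (some (none : Option (Option (Option (Option (Fin 1))))))
  have h₂ := hp (none : Option (Option (Option (Option (Option (Fin 1))))))
  have D := h.definable
  exact definable_imp (D.definable_valuation_lt (D.definableFun_sub hx h₁) hd)
    (definable_imp (D.definable_valuation_lt (D.definableFun_sub hx h₂) hd)
    (definable_imp (definable_not (h₁.ofPred_eq h₂))
    (D.definable_valuation_lt (D.definableFun_sub
      (D.definableFun_div (D.definableFun_sub (definableFun_app hf h₁) (definableFun_app hf h₂))
        (D.definableFun_sub h₁ h₂)) ha) he)))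

end Definability

variable {f : M → M}

/-- Points with an approximate slope occur in every ball, while a point outside the preparing set
has a ball on which having such a slope is constant. The preparing set is definable over `A` alone,
whatever `k` is. -/
theorem exists_approxLinearAt_of_notMem_acl (hA : A.Countable)
    (hf : A.DefinableFun L fun v : Fin 1 → M => f (v 0)) {a k : M} (ha : a ∉ acl L A)
    (hk : k ≠ 0) : ∃ c, ApproxLinearAt O f c k a := by
  have hX : DefinableOverRV L (Level.one O) A {(0 : RV (Level.one O))}
      {a | ∃ c, ApproxLinearAt O f c k a} := by
    apply definable_exists
    exact h.definable_approxLinearAt hf k (Set.DefinableFun.proj _) (Set.DefinableFun.proj _)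
  obtain ⟨C, hC, hCX⟩ := h.prepared _ _ _ _ hX
  obtain ⟨t, ht0, ht⟩ := hCX.exists_ball fun haC => ha ⟨C, hC, hCX.1, haC⟩
  obtain ⟨s, hs0, hs⟩ := h.exists_small ht0
  obtain ⟨b, c, hb, hbc⟩ := h.exists_approxLinearAt hA hf a hs0 hk
  exact (ht b (by simpa [Level.one] using hb.trans_lt hs)).2 ⟨c, hbc⟩

/-- The slopes of a finer precision `|k'| < |k|` form a set of diameter at most `|k'|`. A finite set
preparing it must come within `|k|` of each slope, since otherwise a shift by `k` would stay inside.
-/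
theorem exists_approxLinearAt_mem_acl (hf : A.DefinableFun L fun v : Fin 1 → M => f (v 0))
    {a : M} (ha : a ∈ A) (hap : ∀ k, k ≠ 0 → ∃ c, ApproxLinearAt O f c k a) {k : M}
    (hk : k ≠ 0) : ∃ c ∈ acl L A, ApproxLinearAt O f c k a := by
  obtain ⟨k', hk'0, hk'⟩ := h.exists_small hk
  have hX : DefinableOverRV L (Level.one O) A {(0 : RV (Level.one O))}
      {c | ApproxLinearAt O f c k' a} :=
    h.definable_approxLinearAt hf k' (Set.DefinableFun.proj _) (L.definableFun_const _ ha)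
  obtain ⟨C, hC, hCX⟩ := h.prepared _ _ _ _ hX
  obtain ⟨c, hc⟩ := hap k' hk'0
  by_cases hcz : ∃ z ∈ C, O.valuation (c - z) ≤ O.valuation k
  · obtain ⟨z, hz, hzk⟩ := hcz
    exact ⟨z, ⟨C, hC, hCX.1, hz⟩, hc.mono hk'.le hzk⟩
  · push Not at hcz
    have hck : ApproxLinearAt O f (c + k) k' a := by
      refine (hCX.2.2 c (c + k) fun z hz => rv_eq_of_valuation_sub_lt ?_).1 hc
      simpa [Level.one] using hcz z hz
    have := h.valuation_sub_le_of_approxLinearAt hck hc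
    rw [add_sub_cancel_left] at this
    exact (hk'.not_ge this).elim

/-- A definable function is strictly differentiable at each point that is not algebraic over the
parameters. -/
theorem hasStrictDerivativeAt_of_notMem_acl (hA : A.Countable)
    (hf : A.DefinableFun L fun v : Fin 1 → M => f (v 0)) {a : M} (ha : a ∉ acl L A) :
    HasStrictDerivativeAt O f a := by
  have hex (k : M) (hk : k ≠ 0) := h.exists_approxLinearAt_mem_acl
    (hf.mono (Set.subset_insert a A)) (Set.mem_insert a A)
    (fun k hk => h.exists_approxLinearAt_of_notMem_acl hA hf ha hk) hk
  obtain ⟨e, he0, he⟩ := h.exists_lower_bound (insert a A) (hA.insert a)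
  -- Below the lower bound `|e|`, two slopes in acl that agree up to `|k|` are equal.
  obtain ⟨k, hk0, hk⟩ := h.exists_small he0
  obtain ⟨c, hc, hca⟩ := hex k hk0
  have key (j : M) (hj : j ≠ 0) (hjk : O.valuation j ≤ O.valuation k) :
      ApproxLinearAt O f c j a := by
    obtain ⟨z, hz, hza⟩ := hex j hj
    have hzc := h.valuation_sub_le_of_approxLinearAt
      (hza.mono (c' := z) hjk (by simp)) hca
    have : z - c = 0 := by
      by_contra hne
      exact ((he _ (sub_mem_acl h.definable hz hc) hne).trans hzc).not_gt hk
    rwa [← sub_eq_zero.1 this]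
  rw [hasStrictDerivativeAt_iff]
  refine ⟨c, fun ε hε => ?_⟩
  obtain ⟨j, hj0, hj⟩ := h.exists_small hε
  obtain ⟨d, hd0, hd⟩ : ApproxLinearAt O f c j a := by
    rcases le_total (O.valuation j) (O.valuation k) with hle | hle
    · exact key j hj0 hle
    · exact (key k hk0 le_rfl).mono hle (by simp)
  refine ⟨d, hd0, fun x y hx hy hxy => lt_of_le_of_lt ?_ hj⟩
  rw [Valuation.map_sub_swap] at hx hy
  have hne := sub_ne_zero.2 hxy
  have : (f x - f y) / (x - y) - c = (f x - f y - c * (x - y)) / (x - y) := by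
    field_simp
  rw [this, map_div₀, div_le_iff₀ (by simpa [zero_lt_iff] using hne)]
  exact hd x y hx hy

/-- A bad point outside the preparing set would have a ball of bad points around it, but that ball
contains a point outside acl(A). -/
theorem finite_not_hasStrictDerivativeAt (hA : A.Countable)
    (hf : A.DefinableFun L fun v : Fin 1 → M => f (v 0)) :
    {x | ¬ HasStrictDerivativeAt O f x}.Finite := by
  have hX : DefinableOverRV L (Level.one O) A {(0 : RV (Level.one O))}
      {x | ¬ HasStrictDerivativeAt O f x} :=
    Set.Definable.map_expansion (definable_not (h.definable_hasStrictDerivativeAt hf))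
      FirstOrder.Language.LHom.sumInl
  obtain ⟨C, -, hC⟩ := h.prepared _ _ _ _ hX
  refine hC.1.subset fun x hx => ?_
  by_contra hxC
  obtain ⟨t, ht0, ht⟩ := hC.exists_ball hxC
  obtain ⟨s, hs0, hs⟩ := h.exists_small ht0
  obtain ⟨a, hax, ha⟩ := h.exists_avoiding A hA x s hs0
  refine (ht a (by simpa [Level.one] using hax.trans_lt hs)).1 hx
    (h.hasStrictDerivativeAt_of_notMem_acl hA hf fun haA => ?_)
  have := ha a haA
  rw [sub_self, map_zero, nonpos_iff_eq_zero, Valuation.zero_iff] at this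
  exact hs0 this

end IsSparseModel

/-! ### Ultrapowers of valued fields. -/

open Filter

theorem IsEquicharZeroValuedField.valuation_natCast {L : FirstOrder.Language.{u, v}}
    {φ : valLanguage →ᴸ L} {M : Type w} [Field M] [L.Structure M] {O : ValuationSubring M}
    (h : IsEquicharZeroValuedField φ M O) {n : ℕ} (hn : n ≠ 0) : O.valuation (n : M) = 1 := by
  have := h.residue_charZero
  rcases O.valuation_lt_one_or_eq_one (n : O) with h1 | h1
  · rw [← ValuationSubring.valuation_lt_one_iff, ← IsLocalRing.residue_eq_zero_iff, map_natCast,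
      Nat.cast_eq_zero] at h1
    exact (hn h1).elim
  · simpa using h1

/-- The ultrapower of `K` along `U`. -/
abbrev Ultrapower {ι : Type u} (U : Ultrafilter ι) (K : Type w) : Type (max u w) :=
  (U : Filter ι).Product fun _ => K

namespace Ultrapower

variable {ι : Type u} (U : Ultrafilter ι) {K : Type w}

noncomputable instance [Field K] : Field (Ultrapower U K) :=
  inferInstanceAs (Field (Germ (U : Filter ι) K))

/-- The class of a family of elements of `K`. -/
def mk (x : ι → K) : Ultrapower U K := (x : (U : Filter ι).Product fun _ => K)

/-- The extension of a function on `K` to the ultrapower. -/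
def map (f : K → K) : Ultrapower U K → Ultrapower U K := Germ.map (l := (U : Filter ι)) f

variable {U}

theorem mk_surjective : Function.Surjective (mk U : (ι → K) → Ultrapower U K) :=
  Quotient.mk_surjective

theorem mk_eq_mk {x y : ι → K} : mk U x = mk U y ↔ ∀ᶠ i in U, x i = y i :=
  Quotient.eq''

theorem map_mk (f : K → K) (x : ι → K) : map U f (mk U x) = mk U fun i => f (x i) := rfl

section Field

variable [Field K]

theorem mk_add (x y : ι → K) : mk U x + mk U y = mk U fun i => x i + y i := rfl
theorem mk_sub (x y : ι → K) : mk U x - mk U y = mk U fun i => x i - y i := rfl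
theorem mk_mul (x y : ι → K) : mk U x * mk U y = mk U fun i => x i * y i := rfl
theorem mk_div (x y : ι → K) : mk U x / mk U y = mk U fun i => x i / y i := rfl
theorem mk_neg (x : ι → K) : -mk U x = mk U fun i => -x i := rfl
theorem mk_inv (x : ι → K) : (mk U x)⁻¹ = mk U fun i => (x i)⁻¹ := rfl
theorem zero_eq_mk : (0 : Ultrapower U K) = mk U fun _ => 0 := rfl
theorem one_eq_mk : (1 : Ultrapower U K) = mk U fun _ => 1 := rfl

theorem natCast_eq_mk (n : ℕ) : (n : Ultrapower U K) = mk U fun _ => (n : K) := rfl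

variable (U) in
/-- The valuation ring of the ultrapower. -/
def valuationSubring (O : ValuationSubring K) : ValuationSubring (Ultrapower U K) where
  carrier := {z | ∃ x, z = mk U x ∧ ∀ᶠ i in U, x i ∈ O}
  mul_mem' := by
    rintro _ _ ⟨x, rfl, hx⟩ ⟨y, rfl, hy⟩
    exact ⟨_, mk_mul x y, by filter_upwards [hx, hy] with i using O.mul_mem _ _⟩
  add_mem' := by
    rintro _ _ ⟨x, rfl, hx⟩ ⟨y, rfl, hy⟩
    exact ⟨_, mk_add x y, by filter_upwards [hx, hy] with i using O.add_mem _ _⟩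
  neg_mem' := by
    rintro _ ⟨x, rfl, hx⟩
    exact ⟨_, mk_neg x, by filter_upwards [hx] with i using O.neg_mem _⟩
  one_mem' := ⟨_, one_eq_mk, .of_forall fun _ => O.one_mem⟩
  zero_mem' := ⟨_, zero_eq_mk, .of_forall fun _ => O.zero_mem⟩
  mem_or_inv_mem' := by
    intro z
    obtain ⟨x, rfl⟩ := mk_surjective z
    rcases U.em fun i => x i ∈ O with hx | hx
    · exact Or.inl ⟨x, rfl, hx⟩
    · exact Or.inr ⟨_, mk_inv x, hx.mono fun i hi => (O.mem_or_inv_mem _).resolve_left hi⟩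

variable {O : ValuationSubring K}

theorem mk_mem_valuationSubring {x : ι → K} :
    mk U x ∈ valuationSubring U O ↔ ∀ᶠ i in U, x i ∈ O := by
  constructor
  · rintro ⟨y, hxy, hy⟩
    filter_upwards [mk_eq_mk.1 hxy, hy] with i h1 h2
    rwa [h1]
  · exact fun hx => ⟨x, rfl, hx⟩

theorem valuation_mk_le {x y : ι → K} :
    (valuationSubring U O).valuation (mk U x) ≤ (valuationSubring U O).valuation (mk U y) ↔
      ∀ᶠ i in U, O.valuation (x i) ≤ O.valuation (y i) := by
  simp only [ValuationSubring.valuation_le_iff, Subtype.exists, exists_prop]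
  constructor
  · rintro ⟨z, hz, hzy⟩
    obtain ⟨z, rfl⟩ := mk_surjective z
    rw [mk_mul, mk_eq_mk] at hzy
    filter_upwards [mk_mem_valuationSubring.1 hz, hzy] with i h1 h2
    exact ⟨z i, h1, h2⟩
  · intro hxy
    obtain ⟨z, hz⟩ := hxy.choice
    refine ⟨mk U z, mk_mem_valuationSubring.2 (hz.mono fun i hi => hi.1), ?_⟩
    rw [mk_mul, mk_eq_mk]
    exact hz.mono fun i hi => hi.2

theorem valuation_mk_lt {x y : ι → K} :
    (valuationSubring U O).valuation (mk U x) < (valuationSubring U O).valuation (mk U y) ↔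
      ∀ᶠ i in U, O.valuation (x i) < O.valuation (y i) := by
  simp only [← not_le, valuation_mk_le, Ultrafilter.eventually_not]

end Field

section Structure

variable {L : FirstOrder.Language.{v, w'}} [L.Structure K]

theorem realize_formula [Nonempty K] {β : Type*} (ψ : L.Formula β) (x : β → ι → K) :
    (ψ.Realize fun b => mk U (x b)) ↔ ∀ᶠ i in U, ψ.Realize fun b => x b i :=
  FirstOrder.Language.Ultraproduct.realize_formula_cast ψ x

theorem models_completeTheory [Nonempty K] : Ultrapower U K ⊨ L.completeTheory K := by
  rw [FirstOrder.Language.Theory.model_iff]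
  intro ψ hψ
  rw [FirstOrder.Language.Ultraproduct.sentence_realize]
  exact .of_forall fun _ => hψ

theorem isEquicharZeroValuedField [Field K] {O : ValuationSubring K} {φ : valLanguage →ᴸ L}
    (h : IsEquicharZeroValuedField φ K O) :
    IsEquicharZeroValuedField φ (Ultrapower U K) (valuationSubring U O) where
  nontrivial := by
    intro htop
    refine h.nontrivial (eq_top_iff.2 fun x _ => ?_)
    have : mk U (fun _ => x) ∈ valuationSubring U O := by
      rw [htop]
      trivial
    exact eventually_const.1 (mk_mem_valuationSubring.1 this)
  charZero := by
    have := h.charZero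
    refine charZero_of_inj_zero fun n hn => ?_
    rw [natCast_eq_mk, zero_eq_mk, mk_eq_mk, eventually_const] at hn
    exact_mod_cast hn
  residue_charZero := by
    refine charZero_of_inj_zero fun n hn => ?_
    rw [← map_natCast (IsLocalRing.residue _), IsLocalRing.residue_eq_zero_iff,
      ValuationSubring.valuation_lt_one_iff, ← map_one (valuationSubring U O).valuation] at hn
    have hn' : (valuationSubring U O).valuation (mk U fun _ => (n : K)) <
        (valuationSubring U O).valuation (mk U fun _ => 1) := by
      exact hn
    rw [valuation_mk_lt, eventually_const, map_one] at hn'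
    by_contra hne
    exact hn'.ne (h.valuation_natCast hne)
  add_eq x y := by
    obtain ⟨x, rfl⟩ := mk_surjective x
    obtain ⟨y, rfl⟩ := mk_surjective y
    have hxy : ![mk U x, mk U y] = fun i => mk U (![x, y] i) := by
      funext i
      fin_cases i <;> rfl
    rw [hxy]
    refine (FirstOrder.Language.Ultraproduct.funMap_cast (u := U) (M := fun _ => K)
      (φ.onFunction ValFunctions.add) ![x, y]).trans (mk_eq_mk.2 (.of_forall fun i => ?_))
    refine Eq.trans ?_ (h.add_eq (x i) (y i))
    congr 1
    funext j
    fin_cases j <;> rfl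
  mul_eq x y := by
    obtain ⟨x, rfl⟩ := mk_surjective x
    obtain ⟨y, rfl⟩ := mk_surjective y
    have hxy : ![mk U x, mk U y] = fun i => mk U (![x, y] i) := by
      funext i
      fin_cases i <;> rfl
    rw [hxy]
    refine (FirstOrder.Language.Ultraproduct.funMap_cast (u := U) (M := fun _ => K)
      (φ.onFunction ValFunctions.mul) ![x, y]).trans (mk_eq_mk.2 (.of_forall fun i => ?_))
    refine Eq.trans ?_ (h.mul_eq (x i) (y i))
    congr 1
    funext j
    fin_cases j <;> rfl
  mem_iff x := by
    obtain ⟨x, rfl⟩ := mk_surjective x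
    have := realize_formula (U := U)
      ((φ.onRelation ValRelations.valRing).formula ![FirstOrder.Language.Term.var (0 : Fin 1)])
      ![x]
    simp only [FirstOrder.Language.Formula.realize_rel] at this
    rw [mk_mem_valuationSubring]
    simp only [← h.mem_iff]
    convert! this using 2
    · funext i
      fin_cases i
      rfl
    · funext i
      refine congrArg _ ?_
      funext j
      fin_cases j
      rfl

/-- A formula for `f` involves only finitely many constants; their diagonal images define the
extension, by Łoś. -/
theorem definableFun_map [Nonempty K] {f : K → K} (hf : IsDefinableFunction L f) :
    ∃ A : Set (Ultrapower U K), A.Countable ∧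
      A.DefinableFun L fun v : Fin 1 → Ultrapower U K => map U f (v 0) := by
  rw [IsDefinableFunction, Set.Definable₂, Set.definable_iff_finitely_definable] at hf
  obtain ⟨A₀, -, hf⟩ := hf
  rw [Set.definable_iff_exists_formula_sum] at hf
  obtain ⟨ψ, hψ⟩ := hf
  let const : K → Ultrapower U K := fun a => mk U fun _ => a
  refine ⟨const '' A₀, (A₀.finite_toSet.image _).countable, ?_⟩
  rw [Set.DefinableFun, Set.definable_iff_exists_formula_sum]
  refine ⟨ψ.relabel (Sum.map (fun a : A₀ => ⟨const a, Set.mem_image_of_mem _ a.2⟩)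
    ![some 0, none]), ?_⟩
  ext v
  obtain ⟨x, hx⟩ := mk_surjective (v (some 0))
  obtain ⟨y, hy⟩ := mk_surjective (v none)
  have key := realize_formula (U := U) ψ (Sum.elim (fun (a : A₀) _ => (a : K)) ![x, y])
  have hv : v ∈ Function.tupleGraph (fun v : Fin 1 → Ultrapower U K => map U f (v 0)) ↔
      ∀ᶠ i in U, f (x i) = y i := by
    rw [← mk_eq_mk, ← map_mk, hx, hy]
    rfl
  rw [hv, Set.mem_ofPred_eq, FirstOrder.Language.Formula.realize_relabel]
  have hψ' (i : ι) : ψ.Realize (fun b => Sum.elim (fun (a : A₀) _ => (a : K)) ![x, y] b i) ↔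
      f (x i) = y i := by
    have := Set.ext_iff.1 hψ ![x i, y i]
    simp only [Set.mem_ofPred_eq] at this
    rw [eq_comm]
    refine Iff.trans (iff_of_eq (congrArg _ ?_)) this.symm
    funext b
    rcases b with a | j
    · rfl
    · fin_cases j <;> rfl
  simp only [hψ'] at key
  rw [← key]
  refine iff_of_eq (congrArg _ ?_)
  funext b
  rcases b with a | j
  · rfl
  · fin_cases j
    · exact hx
    · exact hy

end Structure

end Ultrapower

/-! ### Sparseness of a suitable ultrapower. -/

open Filter

namespace Ultrapower

section Sparse

variable {ι : Type u} {U : Ultrafilter ι} {K : Type w} {L : FirstOrder.Language.{v, w'}}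
  [L.Structure K]

/-- If the solution sets were infinite at almost all indices, injective sequences chosen in them
would give infinitely many distinct solutions in the ultrapower. -/
theorem eventually_finite_of_finite [Nonempty K] {β : Type*} (ψ : L.Formula (β ⊕ Fin 1))
    (y : β → ι → K)
    (h : {z | ψ.Realize (Sum.elim (fun b => mk U (y b)) fun _ => z)}.Finite) :
    ∀ᶠ i in U, {z | ψ.Realize (Sum.elim (fun b => y b i) fun _ => z)}.Finite := by
  by_contra hcon
  rw [← Ultrafilter.eventually_not] at hcon
  have hex (i : ι) : ∃ e : ℕ → K,
      ¬ {z | ψ.Realize (Sum.elim (fun b => y b i) fun _ => z)}.Finite →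
        Function.Injective e ∧ ∀ n, ψ.Realize (Sum.elim (fun b => y b i) fun _ => e n) := by
    by_cases hi : {z | ψ.Realize (Sum.elim (fun b => y b i) fun _ => z)}.Finite
    · exact ⟨fun _ => Classical.arbitrary K, fun h => (h hi).elim⟩
    · let e := Set.Infinite.natEmbedding _ hi
      exact ⟨fun n => e n, fun _ => ⟨fun m n hmn => e.injective (Subtype.ext hmn),
        fun n => (e n).2⟩⟩
  choose e he using hex
  refine Set.infinite_of_injective_forall_mem (f := fun n => mk U fun i => e i n) ?_ ?_ h
  · intro m n hmn
    obtain ⟨i, h1, h2⟩ := ((mk_eq_mk.1 hmn).and hcon).exists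
    exact (he i h2).1 h1
  · intro n
    have := (realize_formula (U := U) ψ (Sum.elim y fun _ i => e i n)).2
      (hcon.mono fun i hi => by
        convert! (he i hi).2 n using 1
        funext b
        rcases b with b | b <;> rfl)
    rw [Set.mem_ofPred_eq]
    convert! this using 1
    funext b
    rcases b with b | b <;> rfl

end Sparse

section Generic

/-- The set of finite sets of formulas in one free variable, with countably many parameters. -/
abbrev Index (L : FirstOrder.Language.{u, v}) : Type max u v := Finset (L.Formula (ℕ ⊕ Fin 1))

/-- An ultrafilter that contains, for each formula, the set of finite sets that contain it. -/
noncomputable def ultrafilter (L : FirstOrder.Language.{u, v}) : Ultrafilter (Index L) :=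
  Ultrafilter.of atTop

theorem eventually_mem {L : FirstOrder.Language.{u, v}} (ψ : L.Formula (ℕ ⊕ Fin 1)) :
    ∀ᶠ i : Index L in ultrafilter L, ψ ∈ i := by
  refine Ultrafilter.of_le _ ((eventually_ge_atTop {ψ}).mono fun i hi => ?_)
  simpa using hi

variable {K : Type w} {L : FirstOrder.Language.{u, v}} [L.Structure K]

/-- If in `K` one can satisfy a condition relative to each finite set, then in the ultrapower one
can satisfy it relative to the algebraic closure of a countable set. -/
theorem exists_generic [Nonempty K] {Q : Index L → K → Prop} {P : Index L → K → K → Prop}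
    (hPQ : ∀ i (E : Set K), E.Finite → ∃ a, Q i a ∧ ∀ z ∈ E, P i a z)
    {A : Set (Ultrapower (ultrafilter L) K)} (hA : A.Countable) :
    ∃ a : Index L → K, (∀ i, Q i (a i)) ∧ ∀ z : Index L → K, mk (ultrafilter L) z ∈ acl L A →
      ∀ᶠ i in ultrafilter L, P i (a i) (z i) := by
  have := hA.to_subtype
  obtain ⟨j, hj⟩ := exists_injective_nat A
  choose r hr using fun b : Ultrapower (ultrafilter L) K => mk_surjective b
  -- Naming the parameters by natural numbers lets one index set serve every countable `A`. Unused
  -- numbers get an arbitrary value.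
  let y : ℕ → Index L → K := fun n =>
    Function.extend j (fun b : A => r b) (fun _ _ => Classical.arbitrary K) n
  have hy (b : A) : mk (ultrafilter L) (y (j b)) = b := by
    simp only [y, hj.extend_apply]
    exact hr b
  let S : Index L → L.Formula (ℕ ⊕ Fin 1) → Set K := fun i ψ =>
    {z | ψ.Realize (Sum.elim (fun n => y n i) fun _ => z)}
  -- The coordinate `i` handles only the formulas in `i`, and of these only the ones with finitely
  -- many solutions in `K`, so a finite set has to be avoided there.
  have hfin (i : Index L) : (⋃ ψ ∈ {ψ ∈ (i : Set (L.Formula (ℕ ⊕ Fin 1))) | (S i ψ).Finite},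
      S i ψ).Finite :=
    (i.finite_toSet.subset (Set.sep_subset _ _)).biUnion fun ψ hψ => hψ.2
  choose a ha using fun i => hPQ i _ (hfin i)
  refine ⟨a, fun i => (ha i).1, ?_⟩
  rintro z ⟨E, hE, hEf, hz⟩
  rw [Set.Definable₁, Set.definable_iff_exists_formula_sum] at hE
  obtain ⟨ψ, hψ⟩ := hE
  let ψ' : L.Formula (ℕ ⊕ Fin 1) := ψ.relabel (Sum.map j id)
  have hψ' (x : Ultrapower (ultrafilter L) K) :
      ψ'.Realize (Sum.elim (fun n => mk (ultrafilter L) (y n)) fun _ => x) ↔ x ∈ E := by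
    have h1 := Set.ext_iff.1 hψ fun _ => x
    simp only [Set.mem_ofPred_eq] at h1
    rw [h1, FirstOrder.Language.Formula.realize_relabel]
    refine iff_of_eq (congrArg _ ?_)
    funext b
    rcases b with b | b
    · exact hy b
    · rfl
  have hf := eventually_finite_of_finite ψ' y (hEf.subset fun x hx => (hψ' x).1 hx)
  have hzi : ∀ᶠ i in ultrafilter L, z i ∈ S i ψ' := by
    have h1 := (hψ' _).2 hz
    have h2 := realize_formula (U := ultrafilter L) ψ' (Sum.elim y fun _ => z)
    have h3 : ψ'.Realize fun b => mk (ultrafilter L) (Sum.elim y (fun _ => z) b) := by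
      convert! h1 using 1
      funext b
      rcases b with b | b <;> rfl
    refine (h2.1 h3).mono fun i hi => ?_
    change ψ'.Realize _
    convert! hi using 1
    funext b
    rcases b with b | b <;> rfl
  -- A given algebraic element is handled at almost every coordinate: its formula is in `i`, has
  -- finitely many solutions there, and `z i` is one of them.
  filter_upwards [eventually_mem ψ', hf, hzi] with i h1 h2 h3
  exact (ha i).2 _ (Set.mem_biUnion (show ψ' ∈ {ψ ∈ (i : Set _) | (S i ψ).Finite} from ⟨h1, h2⟩) h3)

theorem isSparseModel [Field K] {O : ValuationSubring K} {φ : valLanguage →ᴸ L}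
    (h : IsEquicharZeroValuedField φ K O)
    (hmin : IsHMinimal.{u, v, max u v w} 1 φ (L.completeTheory K)) :
    IsSparseModel L (valuationSubring (ultrafilter L) O) where
  nontrivial := by
    obtain ⟨x, hx⟩ : ∃ x, x ∉ O := by
      by_contra! hcon
      exact h.nontrivial (eq_top_iff.2 fun x _ => hcon x)
    have hx1 := lt_of_not_ge fun hle => hx ((O.valuation_le_one_iff x).1 hle)
    have hx0 : x ≠ 0 := by
      rintro rfl
      exact hx O.zero_mem
    refine ⟨mk _ fun _ => x⁻¹, ?_, ?_⟩
    · rw [zero_eq_mk, Ne, mk_eq_mk, eventually_const]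
      exact inv_ne_zero hx0
    · rw [← map_one (valuationSubring (ultrafilter L) O).valuation, one_eq_mk, valuation_mk_lt,
        eventually_const, map_inv₀, map_one]
      exact inv_lt_one_of_one_lt₀ hx1
  valuation_natCast n hn := (isEquicharZeroValuedField h).valuation_natCast hn
  definable := (isEquicharZeroValuedField h).definableValuedField
  prepared l A ξ X hX := hmin _ _ (isEquicharZeroValuedField h) models_completeTheory l A {ξ}
    (by simp) X hX
  exists_avoiding A hA b t ht := by
    obtain ⟨b, rfl⟩ := mk_surjective b
    obtain ⟨t, rfl⟩ := mk_surjective t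
    obtain ⟨a, ha, hav⟩ := exists_generic
      (Q := fun i a => O.valuation (a - b i) ≤ O.valuation (t i))
      (P := fun i a z => O.valuation (t i) ≤ O.valuation (a - z)) (fun i E hE => by
        obtain ⟨n, hn⟩ := exists_nat_avoiding (fun n hn => h.valuation_natCast hn) hE (b i) (t i)
        refine ⟨b i + n * t i, ?_, hn⟩
        rw [add_sub_cancel_left, map_mul]
        refine mul_le_of_le_one_left' ?_
        exact (O.valuation_le_one_iff _).2 (natCast_mem O n)) hA
    refine ⟨mk _ a, ?_, fun z hz => ?_⟩
    · rw [mk_sub, valuation_mk_le]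
      exact .of_forall ha
    · obtain ⟨z, rfl⟩ := mk_surjective z
      rw [mk_sub, valuation_mk_le]
      exact hav z hz
  exists_lower_bound A hA := by
    obtain ⟨e, he, hez⟩ := exists_generic (L := L) (Q := fun _ (e : K) => e ≠ 0)
      (P := fun _ e z => z ≠ 0 → O.valuation e ≤ O.valuation z) (fun _ E hE => by
        rcases (E \ {0}).eq_empty_or_nonempty with h0 | h0
        · refine ⟨1, one_ne_zero, fun z hz hz0 => ?_⟩
          exact (h0.subset (⟨hz, hz0⟩ : z ∈ E \ {0})).elim
        · obtain ⟨e, he, hmin⟩ := Set.exists_min_image (E \ {0}) O.valuation hE.sdiff h0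
          exact ⟨e, he.2, fun z hz hz0 => hmin z ⟨hz, hz0⟩⟩) hA
    refine ⟨mk _ e, ?_, fun z hz hz0 => ?_⟩
    · rw [zero_eq_mk, Ne, mk_eq_mk]
      intro hcon
      obtain ⟨i, hi⟩ := hcon.exists
      exact he i hi
    · obtain ⟨z, rfl⟩ := mk_surjective z
      rw [valuation_mk_le]
      rw [zero_eq_mk, Ne, mk_eq_mk, ← Ultrafilter.eventually_not] at hz0
      filter_upwards [hez z hz, hz0] with i h1 h2 using h1 h2

end Generic

/-! ### Descent of strict derivatives to `K`. -/

variable {ι : Type u} {U : Ultrafilter ι} {K : Type w} [Field K] {O : ValuationSubring K}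

theorem mk_ne_zero {x : ι → K} : mk U x ≠ 0 ↔ ∀ᶠ i in U, x i ≠ 0 := by
  rw [zero_eq_mk, Ne, mk_eq_mk, Ultrafilter.eventually_not]

/-- Otherwise each coordinate `a i` of the derivative fails for some `e i`, and counterexamples
chosen coordinatewise refute the derivative in the ultrapower. -/
theorem hasStrictDerivativeAt_of_map {f : K → K} {x : K}
    (h : HasStrictDerivativeAt (valuationSubring U O) (map U f) (mk U fun _ => x)) :
    HasStrictDerivativeAt O f x := by
  rw [hasStrictDerivativeAt_iff] at h ⊢
  obtain ⟨a, ha⟩ := h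
  obtain ⟨a, rfl⟩ := mk_surjective a
  by_contra! hcon
  choose e he0 he using fun i => hcon (a i)
  obtain ⟨d, hd0, hd⟩ := ha (mk U e) (mk_ne_zero.2 (.of_forall he0))
  obtain ⟨d, rfl⟩ := mk_surjective d
  have hy : ∀ i, ∃ y : K × K, d i ≠ 0 → O.valuation (x - y.1) < O.valuation (d i) ∧
      O.valuation (x - y.2) < O.valuation (d i) ∧ y.1 ≠ y.2 ∧
      O.valuation (e i) ≤ O.valuation ((f y.1 - f y.2) / (y.1 - y.2) - a i) := by
    intro i
    by_cases hi : d i = 0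
    · exact ⟨(0, 0), fun h => (h hi).elim⟩
    · obtain ⟨y₁, y₂, h⟩ := he i (d i) hi
      exact ⟨(y₁, y₂), fun _ => h⟩
  choose y hy using hy
  replace hy := (mk_ne_zero.1 hd0).mono hy
  have := hd (mk U fun i => (y i).1) (mk U fun i => (y i).2)
    (by rw [mk_sub, valuation_mk_lt]; exact hy.mono fun i hi => hi.1)
    (by rw [mk_sub, valuation_mk_lt]; exact hy.mono fun i hi => hi.2.1)
    (by rw [Ne, mk_eq_mk, ← Ultrafilter.eventually_not]; exact hy.mono fun i hi => hi.2.2.1)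
  rw [map_mk, map_mk, mk_sub, mk_sub, mk_div, mk_sub, valuation_mk_lt] at this
  obtain ⟨i, h1, h2⟩ := (this.and hy).exists
  exact h1.not_ge h2.2.2.2

end Ultrapower

end HMin

theorem mainTheorem3 {L : FirstOrder.Language.{u, v}} (φ : HMin.valLanguage →ᴸ L)
    {K : Type w} [Field K] [L.Structure K] (O : ValuationSubring K)
    (hK : HMin.IsEquicharZeroValuedField φ K O)
    (hmin : HMin.IsHMinimal.{u, v, max u v w} 1 φ (L.completeTheory K))
    (f : K → K) (hf : HMin.IsDefinableFunction L f) :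
    {x : K | ¬ HMin.HasStrictDerivativeAt O f x}.Finite := by
  obtain ⟨A, hA, hfA⟩ := HMin.Ultrapower.definableFun_map (U := HMin.Ultrapower.ultrafilter L) hf
  have hfin := (HMin.Ultrapower.isSparseModel hK hmin).finite_not_hasStrictDerivativeAt hA hfA
  refine (hfin.preimage (f := fun x => HMin.Ultrapower.mk _ fun _ => x) ?_).subset
    fun x hx h => hx (HMin.Ultrapower.hasStrictDerivativeAt_of_map h)
  intro x _ y _ hxy
  exact Filter.eventually_const.1 (HMin.Ultrapower.mk_eq_mk.1 hxy)
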